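/- Consider the following algorithm for maintaining a topological order of a directed acyclic graph on a finite set $V$ of $n$ vertices under edge insertions. The current order is a bijection $T:V\to\{1,\dots,n\}$; write $u<v$ for $T(u)<T(v)$, $u\to v$ if $(u,v)$ is a current edge, and $d(u,v)=|T(v)-T(u)|$. Fix an integer $p\ge 0$ and real thresholds $\sqrt n<t_0<t_1<\dots<t_p<t_{p+1}=n$. $\textsc{Insert}(u,v)$: if $v\le u$, call $\textsc{Reorder}(v,u,0,0)$; then add the edge $(u,v)$ to the graph. $\textsc{Reorder}(u,v,f_1,f_2)$: if $v\le u$, exit. Otherwise put $\hat A_i=\{w: u\to w,\ d(u,w)\le t_i,\ w<v\}$ and $\hat B_i=\{w: w\to v,\ d(w,v)\le t_i,\ w>u\}$. If $t_i<d(u,v)\le t_{i+1}$ for some $0\le i\le p$, let $A=\hat A_i$ if $\hat A_i\ne\emptyset$ or $f_1=1$, and $A=\hat A_{i+1}$ otherwise, and let $B=\hat B_i$ if $\hat B_i\neq\emptyset$ or $f_2=1$, and $B=\hat B_{i+1}$ otherwise. If $d(u,v)\le t_0$, let $A=\hat A_0$ and $B=\hat B_0$. If $A=B=\emptyset$, swap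 the positions of $u$ and $v$ in $T$ and exit. Otherwise, for each $u'\in\{u\}\cup A$ in decreasing order, and for each $v'\in B\cup\{v\}$ with $v'>u'$ in increasing order (all with respect to the order $T$ at the start of this call), call $\textsc{Reorder}(u',v',f_1',f_2')$, where $f_1'=1$ if and only if $u'=u$ and $A=\emptyset$, and $f_2'=1$ if and only if $v'=v$ and $B=\emptyset$. Start from any directed acyclic graph on $V$ with any topological order $T$ of it, and insert any finite sequence of edges, one after the other, such that the graph stays acyclic. Then the algorithm terminates and every unordered pair of vertices is swapped at most once. For an ordered pair $(u,v)$ of vertices let $D(u,v)$ be the value of $d(u,v)$ at the moment at which $u$ and $v$ are swapped, if they are swapped at a moment when $u<v$, and $D(u,v)=0$ otherwise; let $D_k(u,v)=\min(D(u,v),k)$. **Theorem.** There is an absolute constant $C>0$ (independent of $n$, $p$, the thresholds, the starting graph and order, the inserted edges, and $k$) such that for every real $k$ with $\sqrt n\le k\le n$, $$\sum_{u,v\in V} D_k(u,v)\le C\,n^2\sqrt k .$$ -/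

import Mathlib

namespace OnlineTopo

universe u

variable {V : Type u} [Fintype V] [DecidableEq V]

/-- A linear order of the vertices, as a bijection onto the `n = |V|` positions
(numbered from `0`; only comparisons and differences of positions are ever used). -/
abbrev Order (V : Type u) [Fintype V] : Type u := V ≃ Fin (Fintype.card V)

/-- The directed graph with edge set `E` is acyclic: no vertex reaches itself by a nonempty path. -/
def Acyclic (E : Finset (V × V)) : Prop :=
  ∀ x : V, ¬ Relation.TransGen (fun a b => (a, b) ∈ E) x x

/-- `T` is a topological order of the directed graph with edge set `E`. -/
def IsTopologicalOrder (E : Finset (V × V)) (T : Order V) : Prop :=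
  ∀ a b : V, (a, b) ∈ E → T a < T b

/-- The distance `d(a,b) = |T(b) - T(a)|`. -/
def dist (T : Order V) (a b : V) : ℕ :=
  (((T b : ℕ) : ℤ) - ((T a : ℕ) : ℤ)).natAbs

open Classical in
/-- `{w : u → w, d(u,w) ≤ r, w < v}`. -/
noncomputable def outNear (E : Finset (V × V)) (T : Order V) (u v : V) (r : ℝ) : Finset V :=
  Finset.univ.filter fun w => (u, w) ∈ E ∧ (dist T u w : ℝ) ≤ r ∧ T w < T v

open Classical in
/-- `{w : w → v, d(w,v) ≤ r, w > u}`. -/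
noncomputable def inNear (E : Finset (V × V)) (T : Order V) (u v : V) (r : ℝ) : Finset V :=
  Finset.univ.filter fun w => (w, v) ∈ E ∧ (dist T w v : ℝ) ≤ r ∧ T u < T w

open Classical in
/-- The set `A` computed by the call `Reorder(u,v,f₁,f₂)`, for thresholds `t₀ < ⋯ < t_{p+1}`.
If `t_i < d(u,v) ≤ t_{i+1}` (the index `i` is unique as `t` is strictly increasing), then the
set with radius `t_i` is taken if it is nonempty or `f₁ = 1`, and the one with radius `t_{i+1}`
otherwise; if there is no such `i`, the set with radius `t₀` is taken. -/
noncomputable def setA {p : ℕ} (t : Fin (p + 2) → ℝ) (E : Finset (V × V)) (T : Order V)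
    (u v : V) (f₁ : Bool) : Finset V :=
  if h : ∃ i : Fin (p + 1), t i.castSucc < dist T u v ∧ (dist T u v : ℝ) ≤ t i.succ then
    if (outNear E T u v (t h.choose.castSucc)).Nonempty ∨ f₁ = true then
      outNear E T u v (t h.choose.castSucc)
    else outNear E T u v (t h.choose.succ)
  else outNear E T u v (t 0)

open Classical in
/-- The set `B` computed by the call `Reorder(u,v,f₁,f₂)`, symmetric to `setA`. -/
noncomputable def setB {p : ℕ} (t : Fin (p + 2) → ℝ) (E : Finset (V × V)) (T : Order V)
    (u v : V) (f₂ : Bool) : Finset V :=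
  if h : ∃ i : Fin (p + 1), t i.castSucc < dist T u v ∧ (dist T u v : ℝ) ≤ t i.succ then
    if (inNear E T u v (t h.choose.castSucc)).Nonempty ∨ f₂ = true then
      inNear E T u v (t h.choose.castSucc)
    else inNear E T u v (t h.choose.succ)
  else inNear E T u v (t 0)

/-- The elements of `S`, listed by increasing position. -/
def increasing (T : Order V) (S : Finset V) : List V :=
  ((S.image T).sort (fun a b => a ≤ b)).map T.symm

/-- The elements of `S`, listed by decreasing position. -/
def decreasing (T : Order V) (S : Finset V) : List V :=
  (increasing T S).reverse

/-- The instructions on the control stack of the algorithm. -/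
inductive Instr (V : Type u) : Type u
  /-- The call `Insert(u,v)`. -/
  | insertEdge (u v : V)
  /-- Add the edge `(u,v)` to the graph (the second line of `Insert`). -/
  | addEdge (u v : V)
  /-- The call `Reorder(u,v,f₁,f₂)`. -/
  | reorder (u v : V) (f₁ f₂ : Bool)

/-- The recursive calls made by the two nested loops of `Reorder(u,v,·,·)`: the outer loop runs
over `u' ∈ {u} ∪ A` by decreasing position, the inner loop over the `v' ∈ B ∪ {v}` with `v' > u'`
by increasing position, where positions are those at the start of the call. -/
def subcalls (T : Order V) (u v : V) (A B : Finset V) : List (Instr V) :=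
  (decreasing T (insert u A)).flatMap fun u' =>
    (increasing T ((insert v B).filter fun v' => T u' < T v')).map fun v' =>
      Instr.reorder u' v' (decide (u' = u ∧ A = ∅)) (decide (v' = v ∧ B = ∅))

/-- A state of the execution: the current graph, the current order, the control stack, and the
log of all swaps made so far. A swap of `u` and `v` made by `Reorder(u,v,·,·)` at a moment when
`u < v` is logged as `((u, v), d(u,v))`, with `d(u,v)` measured right before the swap. -/
structure State (V : Type u) [Fintype V] : Type u where
  E : Finset (V × V)
  T : Order V
  todo : List (Instr V)
  swaps : List ((V × V) × ℕ)

/-- One step of the execution: carry out the instruction on top of the control stack. -/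
noncomputable def step {p : ℕ} (t : Fin (p + 2) → ℝ) (s : State V) : State V :=
  match s.todo with
  | [] => s
  | Instr.insertEdge u v :: rest =>
      if s.T v ≤ s.T u then
        { s with todo := Instr.reorder v u false false :: Instr.addEdge u v :: rest }
      else { s with todo := Instr.addEdge u v :: rest }
  | Instr.addEdge u v :: rest => { s with E := insert (u, v) s.E, todo := rest }
  | Instr.reorder u v f₁ f₂ :: rest =>
      if s.T v ≤ s.T u then { s with todo := rest }
      else if setA t s.E s.T u v f₁ = ∅ ∧ setB t s.E s.T u v f₂ = ∅ then
        { s with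
          T := (Equiv.swap u v).trans s.T
          todo := rest
          swaps := s.swaps ++ [((u, v), dist s.T u v)] }
      else
        { s with
          todo := subcalls s.T u v (setA t s.E s.T u v f₁) (setB t s.E s.T u v f₂) ++ rest }

/-- The initial state for inserting the edges in the list `es`, one after the other, into the
graph `E₀` with order `T₀`. -/
def start (E₀ : Finset (V × V)) (T₀ : Order V) (es : List (V × V)) : State V where
  E := E₀
  T := T₀
  todo := es.map fun e => Instr.insertEdge e.1 e.2
  swaps := []

/-- The execution from `s₀` terminates in the state `s`. The execution is deterministic and stays
put once the control stack is empty, so there is at most one such `s`. -/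
def HaltsIn {p : ℕ} (t : Fin (p + 2) → ℝ) (s₀ s : State V) : Prop :=
  ∃ N : ℕ, (step t)^[N] s₀ = s ∧ s.todo = []

/-- No two entries of the log concern the same unordered pair of vertices. -/
def EachPairSwappedAtMostOnce (L : List ((V × V) × ℕ)) : Prop :=
  (L.map fun e => s(e.1.1, e.1.2)).Nodup

/-- `D(u,v)`: the value of `d(u,v)` at the swap of `u` and `v` with `u < v`, and `0` if there is
no such swap. -/
def D (L : List ((V × V) × ℕ)) (u v : V) : ℕ :=
  (L.lookup (u, v)).getD 0

/-- `D_k(u,v)`: the value `D(u,v)` if it is at most `k`, and `k` otherwise. -/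
noncomputable def Dk (L : List ((V × V) × ℕ)) (k : ℝ) (u v : V) : ℝ :=
  open Classical in if (D L u v : ℝ) ≤ k then (D L u v : ℝ) else k

end OnlineTopo

namespace OnlineTopo

open Relation

set_option linter.unusedSectionVars false

universe u

variable {V : Type u} [Fintype V] [DecidableEq V]

/-! While the edge $(x,y)$ is being inserted, every pending call `Reorder(u,v)` has paths $y\leadsto
u$ and $v\leadsto x$. By acyclicity no vertex is both reachable from $y$ and able to reach $x$, so
swaps only raise the former kind of vertex and only lower the latter. Hence a swapped pair stays
reversed until $(x,y)$ is added, and from then on a path $v\leadsto u$ keeps it reversed. So no pair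
is swapped twice, and since every active call leads to a swap, the run terminates (`invariant_step`,
`eventually_halts`).

The bound is a potential argument in the final order $T$. A swap at distance $d$ moves $u$ up and
$v$ down by $d$, so $\sum_w T(w)(T(w)-T_0(w))$ is the sum of $d\,(T(u)-T(v))$ over all swaps. Every
term is nonnegative and the total is at most $n^3$ (`Invariant.sum_D_mul_le`). Pairs at final
distance at most $l$ number at most $nl$ and cost at most $k$ each; the others cost at most $n^3/l$
together. Taking $l=n/\sqrt k$ gives $2n^2\sqrt k$. -/

/-- The adjacency relation of the directed graph with edge set `E`. -/
abbrev Edge (E : Finset (V × V)) (a b : V) : Prop := (a, b) ∈ E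

/-! ### Sorted lists of vertices and the list of recursive calls -/

theorem mem_increasing {T : Order V} {S : Finset V} {w : V} : w ∈ increasing T S ↔ w ∈ S := by
  simp [increasing]

theorem mem_decreasing {T : Order V} {S : Finset V} {w : V} : w ∈ decreasing T S ↔ w ∈ S := by
  simp [decreasing, mem_increasing]

theorem pairwise_increasing (T : Order V) (S : Finset V) :
    (increasing T S).Pairwise fun a b => T a < T b := by
  unfold increasing
  rw [List.pairwise_map]
  simpa using (Finset.sortedLT_sort (S.image T)).pairwise

theorem increasing_eq_append {T : Order V} {S : Finset V} {m : V} (hm : m ∈ S)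
    (hmax : ∀ w ∈ S, T w ≤ T m) : ∃ l, increasing T S = l ++ [m] := by
  obtain ⟨l₁, l₂, h⟩ := List.append_of_mem (mem_increasing (T := T).2 hm)
  have hp := pairwise_increasing T S
  rw [h] at hp
  cases l₂ with
  | nil => exact ⟨l₁, h⟩
  | cons a l =>
    have h1 : T m < T a := by
      have := (List.pairwise_append.1 hp).2.1
      exact (List.pairwise_cons.1 this).1 a (by simp)
    have h2 : a ∈ S := by rw [← mem_increasing (T := T), h]; simp
    exact absurd (hmax a h2) (not_le.2 h1)

theorem increasing_eq_cons {T : Order V} {S : Finset V} {m : V} (hm : m ∈ S)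
    (hmin : ∀ w ∈ S, T m ≤ T w) : ∃ l, increasing T S = m :: l := by
  obtain ⟨l₁, l₂, h⟩ := List.append_of_mem (mem_increasing (T := T).2 hm)
  have hp := pairwise_increasing T S
  rw [h] at hp
  cases l₁ with
  | nil => exact ⟨l₂, h⟩
  | cons a l =>
    have h1 : T a < T m := (List.pairwise_append.1 hp).2.2 a (by simp) m (by simp)
    have h2 : a ∈ S := by rw [← mem_increasing (T := T), h]; simp
    exact absurd (hmin a h2) (not_le.2 h1)

theorem mem_subcalls {T : Order V} {u v : V} {A B : Finset V} {r : Instr V} :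
    r ∈ subcalls T u v A B ↔ ∃ u' ∈ insert u A, ∃ v' ∈ insert v B, T u' < T v' ∧
      Instr.reorder u' v' (decide (u' = u ∧ A = ∅)) (decide (v' = v ∧ B = ∅)) = r := by
  simp only [subcalls, List.mem_flatMap, List.mem_map, mem_decreasing, mem_increasing,
    Finset.mem_filter, and_assoc]

/-- Both loops end at the extreme pair, so the last recursive call repeats `(u, v)`. This is why
`Reorder(y,x)` stays at the bottom of the stack until $x<y$ holds. -/
theorem subcalls_eq_append {T : Order V} {u v : V} {A B : Finset V} (huv : T u < T v)
    (hA : ∀ w ∈ A, T u < T w) (hB : ∀ w ∈ B, T w < T v) :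
    ∃ R f₁ f₂, subcalls T u v A B = R ++ [Instr.reorder u v f₁ f₂] := by
  obtain ⟨l, hl⟩ := increasing_eq_cons (T := T) (Finset.mem_insert_self u A) (by
    intro w hw
    rcases Finset.mem_insert.1 hw with rfl | hw
    exacts [le_rfl, (hA w hw).le])
  obtain ⟨l', hl'⟩ := increasing_eq_append (T := T) (m := v)
    (S := (insert v B).filter fun v' => T u < T v') (by simp [huv]) (by
      intro w hw
      rcases Finset.mem_insert.1 (Finset.mem_filter.1 hw).1 with rfl | hw
      exacts [le_rfl, (hB w hw).le])
  simp only [subcalls, decreasing, hl, List.reverse_cons, List.flatMap_append,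
    List.flatMap_singleton, hl', List.map_append, List.map_cons, List.map_nil]
  exact ⟨_, _, _, (List.append_assoc _ _ _).symm⟩

/-- The first recursive call takes the topmost vertex of $\{u\}\cup A$ and the next vertex of
$B\cup\{v\}$ above it. One end moves strictly inward because $A$ or $B$ is nonempty; this is the
descent behind `eventually_swap`. -/
theorem subcalls_eq_cons {T : Order V} {u v : V} {A B : Finset V} (huv : T u < T v)
    (hA : ∀ w ∈ A, T u < T w ∧ T w < T v) (hB : ∀ w ∈ B, T u < T w ∧ T w < T v)
    (hne : ¬ (A = ∅ ∧ B = ∅)) :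
    ∃ u' v' f₁ f₂ R, subcalls T u v A B = Instr.reorder u' v' f₁ f₂ :: R ∧ T u' < T v' ∧
      ((T v' : ℕ) - T u' : ℕ) < (T v : ℕ) - T u := by
  obtain ⟨a, ha, hamax⟩ := Finset.exists_max_image (insert u A) T ⟨u, by simp⟩
  have hav : T a < T v := by
    rcases Finset.mem_insert.1 ha with rfl | ha
    exacts [huv, (hA a ha).2]
  obtain ⟨b, hb, hbmin⟩ := Finset.exists_min_image
    ((insert v B).filter fun v' => T a < T v') T ⟨v, by simp [hav]⟩
  obtain ⟨l, hl⟩ := increasing_eq_append ha hamax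
  obtain ⟨l', hl'⟩ := increasing_eq_cons hb hbmin
  refine ⟨a, b, decide (a = u ∧ A = ∅), decide (b = v ∧ B = ∅), ?_⟩
  refine exists_and_right.2 ⟨?_, (Finset.mem_filter.1 hb).2, ?_⟩
  · simp only [subcalls, decreasing, hl, List.reverse_append, List.reverse_cons, List.reverse_nil,
      List.nil_append, List.cons_append, List.flatMap_cons, hl', List.map_cons]
    exact ⟨_, rfl⟩
  · have h1 : T u ≤ T a := hamax u (by simp)
    have h2 : T b ≤ T v := hbmin v (by simp [hav])
    have h3 : T u < T a ∨ T b < T v := by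
      rcases A.eq_empty_or_nonempty with rfl | ⟨w, hw⟩
      · obtain ⟨w, hw⟩ : B.Nonempty := by
          rw [Finset.nonempty_iff_ne_empty]
          exact fun h => hne ⟨rfl, h⟩
        have hau : a = u := by simpa using ha
        subst hau
        exact Or.inr ((hbmin w (by simp [hw, hB w hw])).trans_lt (hB w hw).2)
      · exact Or.inl ((hA w hw).1.trans_le (hamax w (by simp [hw])))
    simp only [Fin.lt_def, Fin.le_def] at *
    omega

/-! ### The sets computed by a call -/

theorem exists_threshold {p : ℕ} (t : Fin (p + 2) → ℝ) {x : ℝ} (h0 : t 0 < x)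
    (hl : x ≤ t (Fin.last (p + 1))) : ∃ i : Fin (p + 1), t i.castSucc < x ∧ x ≤ t i.succ := by
  by_contra! h
  have key : ∀ j : Fin (p + 2), t j < x := by
    intro j
    induction j using Fin.induction with
    | zero => exact h0
    | succ i ih => exact h i ih
  exact absurd hl (not_le.2 (key _))

theorem dist_le_card (T : Order V) (a b : V) : dist T a b ≤ Fintype.card V := by
  have := (T a).isLt
  have := (T b).isLt
  unfold dist
  omega

theorem edge_of_mem_setA {p : ℕ} {t : Fin (p + 2) → ℝ} {E : Finset (V × V)} {T : Order V}
    {u v w : V} {f : Bool} (h : w ∈ setA t E T u v f) : (u, w) ∈ E ∧ T w < T v := by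
  unfold setA at h
  split_ifs at h <;> simp only [outNear, Finset.mem_filter] at h <;> exact ⟨h.2.1, h.2.2.2⟩

theorem edge_of_mem_setB {p : ℕ} {t : Fin (p + 2) → ℝ} {E : Finset (V × V)} {T : Order V}
    {u v w : V} {f : Bool} (h : w ∈ setB t E T u v f) : (w, v) ∈ E ∧ T u < T w := by
  unfold setB at h
  split_ifs at h <;> simp only [inNear, Finset.mem_filter] at h <;> exact ⟨h.2.1, h.2.2.2⟩

/-- If `setA` is empty then no out-neighbour of `u` lies before `v`, at any distance. -/
theorem le_of_setA_eq_empty {p : ℕ} {t : Fin (p + 2) → ℝ}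
    (ht : t (Fin.last (p + 1)) = Fintype.card V) {E : Finset (V × V)} {T : Order V}
    (hT : IsTopologicalOrder E T) {u v : V} {f : Bool}
    (hf : f = true → ∀ w, (u, w) ∈ E → T v < T w) (h : setA t E T u v f = ∅) {w : V}
    (hw : (u, w) ∈ E) : T v ≤ T w := by
  by_contra! hlt
  have huw := hT u w hw
  have hd : (dist T u w : ℝ) ≤ dist T u v := by
    simp only [Fin.lt_def] at hlt huw
    unfold dist
    rw [Nat.cast_le]
    omega
  have key : ∀ r : ℝ, (dist T u v : ℝ) ≤ r → w ∈ outNear E T u v r := fun r hr => by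
    simp [outNear, hw, hlt, hd.trans hr]
  unfold setA at h
  split_ifs at h with h1 h2
  · rcases h2 with h2 | h2
    · exact h2.ne_empty h
    · exact absurd (hf h2 w hw) (not_lt.2 hlt.le)
  -- The larger radius is at least $d(u,v)$, so it already captures every neighbour in between.
  · have := key _ h1.choose_spec.2
    simp [h] at this
  -- As $t_{p+1}=n$ bounds all distances, lying in no threshold interval forces $d(u,v)\le t_0$.
  · have h0 : (dist T u v : ℝ) ≤ t 0 := by
      by_contra! h0
      exact h1 (exists_threshold t h0 (by rw [ht]; exact_mod_cast dist_le_card T u v))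
    have := key _ h0
    simp [h] at this

/-- If `setB` is empty then no in-neighbour of `v` lies after `u`, at any distance. -/
theorem le_of_setB_eq_empty {p : ℕ} {t : Fin (p + 2) → ℝ}
    (ht : t (Fin.last (p + 1)) = Fintype.card V) {E : Finset (V × V)} {T : Order V}
    (hT : IsTopologicalOrder E T) {u v : V} {f : Bool}
    (hf : f = true → ∀ w, (w, v) ∈ E → T w < T u) (h : setB t E T u v f = ∅) {w : V}
    (hw : (w, v) ∈ E) : T w ≤ T u := by
  by_contra! hlt
  have hwv := hT w v hw
  have hd : (dist T w v : ℝ) ≤ dist T u v := by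
    simp only [Fin.lt_def] at hlt hwv
    unfold dist
    rw [Nat.cast_le]
    omega
  have key : ∀ r : ℝ, (dist T u v : ℝ) ≤ r → w ∈ inNear E T u v r := fun r hr => by
    simp [inNear, hw, hlt, hd.trans hr]
  unfold setB at h
  split_ifs at h with h1 h2
  · rcases h2 with h2 | h2
    · exact h2.ne_empty h
    · exact absurd (hf h2 w hw) (not_lt.2 hlt.le)
  · have := key _ h1.choose_spec.2
    simp [h] at this
  · have h0 : (dist T u v : ℝ) ≤ t 0 := by
      by_contra! h0
      exact h1 (exists_threshold t h0 (by rw [ht]; exact_mod_cast dist_le_card T u v))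
    have := key _ h0
    simp [h] at this

theorem IsTopologicalOrder.lt_of_transGen {E : Finset (V × V)} {T : Order V}
    (hT : IsTopologicalOrder E T) {a b : V} (h : TransGen (Edge E) a b) : T a < T b := by
  induction h with
  | single h => exact hT _ _ h
  | tail _ h ih => exact ih.trans (hT _ _ h)

/-! ### The effect of a swap -/

theorem swap_trans_apply (T : Order V) (u v w : V) :
    (Equiv.swap u v).trans T w = if w = u then T v else if w = v then T u else T w := by
  simp only [Equiv.trans_apply, Equiv.swap_apply_def]
  split_ifs <;> rfl

theorem isTopologicalOrder_swap {E : Finset (V × V)} {T : Order V}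
    (hT : IsTopologicalOrder E T) {u v : V} (huv : T u < T v) (hE : (u, v) ∉ E)
    (hA : ∀ w, (u, w) ∈ E → T v ≤ T w) (hB : ∀ w, (w, v) ∈ E → T w ≤ T u) :
    IsTopologicalOrder E ((Equiv.swap u v).trans T) := by
  intro a b hab
  have hlt := hT a b hab
  rw [swap_trans_apply, swap_trans_apply]
  split_ifs with h1 h2 h3 h4 h5 h6 h7 h8
  · subst h1; subst h2; exact absurd hlt (lt_irrefl _)
  · subst h1; subst h3; exact absurd hab hE
  · subst h1
    exact lt_of_le_of_ne (hA b hab) fun h => h3 (T.injective h).symm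
  · exact huv
  · subst h4; subst h6; exact absurd hlt (lt_irrefl _)
  · subst h4; exact huv.trans hlt
  · subst h7; exact hlt.trans huv
  · subst h8
    exact lt_of_le_of_ne (hB a hab) fun h => h1 (T.injective h)
  · exact hlt

/-- The net displacement of `w` caused by the swap recorded in the log entry `e`. -/
def displacement (w : V) (e : (V × V) × ℕ) : ℤ :=
  (if e.1.1 = w then (e.2 : ℤ) else 0) - if e.1.2 = w then (e.2 : ℤ) else 0

theorem swap_displacement {T : Order V} {u v : V} (huv : T u < T v) (w : V) :
    (((Equiv.swap u v).trans T w : ℕ) : ℤ) =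
      ((T w : ℕ) : ℤ) + displacement w ((u, v), dist T u v) := by
  have hne : u ≠ v := by rintro rfl; exact lt_irrefl _ huv
  rw [swap_trans_apply]
  simp only [displacement, dist, Fin.lt_def] at *
  by_cases h1 : w = u
  · subst h1
    simp only [if_true, if_neg hne.symm]
    omega
  · by_cases h2 : w = v
    · subst h2
      simp only [if_true, if_neg hne, if_neg h1]
      omega
    · simp [h1, h2, Ne.symm h1, Ne.symm h2]

/-! ### The invariant of the execution -/

/-- The condition on a pending recursive call while the edge `(x, y)` is being inserted. -/
def ValidCall (E : Finset (V × V)) (T : Order V) (x y : V) : Instr V → Prop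
  | Instr.reorder u v f₁ f₂ =>
      ReflTransGen (Edge E) y u ∧ ReflTransGen (Edge E) v x ∧
        (f₁ = true → ∀ w, (u, w) ∈ E → T v < T w) ∧ (f₂ = true → ∀ w, (w, v) ∈ E → T w < T u)
  | _ => False

/-- The condition on the control stack and the log between two insertions. -/
def Idle (G : Finset (V × V)) (s : State V) : Prop :=
  ∃ es : List (V × V), (∀ e ∈ es, e ∈ G) ∧
    s.todo = es.map (fun e => Instr.insertEdge e.1 e.2) ∧
    ∀ e ∈ s.swaps, TransGen (Edge s.E) e.1.2 e.1.1

/-- The condition on the control stack and the log during the insertion of an edge. -/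
def Busy (G : Finset (V × V)) (s : State V) : Prop :=
  ∃ (es : List (V × V)) (x y : V) (R : List (Instr V)), (∀ e ∈ es, e ∈ G) ∧ (x, y) ∈ G ∧
    s.todo = R ++ Instr.addEdge x y :: es.map (fun e => Instr.insertEdge e.1 e.2) ∧
    (∀ r ∈ R, ValidCall s.E s.T x y r) ∧
    (s.T x < s.T y ∨ ∃ R' f₁ f₂, R = R' ++ [Instr.reorder y x f₁ f₂]) ∧
    ∀ e ∈ s.swaps, TransGen (Edge s.E) e.1.2 e.1.1 ∨
      (s.T e.1.2 < s.T e.1.1 ∧ ReflTransGen (Edge s.E) e.1.2 x ∧ ReflTransGen (Edge s.E) y e.1.1)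

/-- The invariant of an execution that starts with the order `T₀` and inserts edges of `G`. -/
structure Invariant (G : Finset (V × V)) (T₀ : Order V) (s : State V) : Prop where
  topological : IsTopologicalOrder s.E s.T
  subset : s.E ⊆ G
  displaced : ∀ w, ((s.T w : ℕ) : ℤ) = ((T₀ w : ℕ) : ℤ) + (s.swaps.map (displacement w)).sum
  swappedOnce : EachPairSwappedAtMostOnce s.swaps
  phase : Idle G s ∨ Busy G s

theorem invariant_start {E₀ : Finset (V × V)} {T₀ : Order V} {es : List (V × V)}
    (hT : IsTopologicalOrder E₀ T₀) : Invariant (E₀ ∪ es.toFinset) T₀ (start E₀ T₀ es) where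
  topological := hT
  subset := Finset.subset_union_left
  displaced := by simp [start]
  swappedOnce := by simp [start, EachPairSwappedAtMostOnce]
  phase := Or.inl ⟨es, by simp +contextual, rfl, by simp [start]⟩

theorem Edge.mono_refl {E G : Finset (V × V)} (h : E ⊆ G) {a b : V}
    (hab : ReflTransGen (Edge E) a b) : ReflTransGen (Edge G) a b :=
  ReflTransGen.mono (fun _ _ h' => h h') _ _ hab

theorem Edge.mono_trans {E G : Finset (V × V)} (h : E ⊆ G) {a b : V}
    (hab : TransGen (Edge E) a b) : TransGen (Edge G) a b :=
  TransGen.mono (fun _ _ h' => h h') _ _ hab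

/-- A path to `x`, the edge `(x, y)` and a path from `y` form a path. -/
theorem transGen_through {G : Finset (V × V)} {x y a b : V} (hxy : (x, y) ∈ G)
    (ha : ReflTransGen (Edge G) a x) (hb : ReflTransGen (Edge G) y b) :
    TransGen (Edge G) a b :=
  (TransGen.tail' ha hxy).trans_left hb

theorem invariant_step_idle {p : ℕ} {t : Fin (p + 2) → ℝ} {G : Finset (V × V)} {T₀ : Order V}
    {s : State V} (hs : Invariant G T₀ s) (hI : Idle G s) :
    Invariant G T₀ (step t s) := by
  obtain ⟨E, T, todo, swaps⟩ := s
  obtain ⟨es, hes, htodo, hlog⟩ := hI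
  simp only at htodo
  subst htodo
  cases es with
  | nil => exact hs
  | cons e es =>
    obtain ⟨x, y⟩ := e
    have hxy : (x, y) ∈ G := hes _ (by simp)
    have hes' : ∀ e ∈ es, e ∈ G := fun e he => hes e (by simp [he])
    simp only [List.map_cons, step]
    split_ifs with h
    · refine ⟨hs.1, hs.2, hs.3, hs.4, Or.inr ⟨es, x, y, [Instr.reorder y x false false], hes', hxy,
        rfl, ?_, Or.inr ⟨[], false, false, rfl⟩, fun e he => Or.inl (hlog e he)⟩⟩
      simp [ValidCall, ReflTransGen.refl]
    · exact ⟨hs.1, hs.2, hs.3, hs.4, Or.inr ⟨es, x, y, [], hes', hxy, rfl, by simp,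
        Or.inl (not_le.1 h), fun e he => Or.inl (hlog e he)⟩⟩

/-- Everything rests on monotonicity: a swap raises only vertices reachable from $y$ and lowers only
vertices that reach $x$. This preserves the meaning of the flags on pending calls and the order of
pairs already swapped. The clause on the last call guarantees $x<y$ when the edge is finally added.
-/
theorem invariant_step_busy {p : ℕ} {t : Fin (p + 2) → ℝ}
    (ht : t (Fin.last (p + 1)) = Fintype.card V) {G : Finset (V × V)} (hG : Acyclic G)
    {T₀ : Order V} {s : State V} (hs : Invariant G T₀ s) (hB : Busy G s) :
    Invariant G T₀ (step t s) := by
  obtain ⟨E, T, todo, swaps⟩ := s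
  obtain ⟨es, x, y, R, hes, hxy, htodo, hR, hlast, hlog⟩ := hB
  obtain ⟨hT, hEG, hdisp, hnodup, -⟩ := hs
  simp only at htodo hR hlast hlog hT hEG hdisp hnodup
  subst htodo
  -- A vertex between $y$ and $x$ would close a cycle through $(x,y)$ in the final graph.
  have hcycle : ∀ {a}, ReflTransGen (Edge E) y a → ReflTransGen (Edge E) a x → False :=
    fun h1 h2 => hG x (transGen_through hxy .refl (Edge.mono_refl hEG (h1.trans h2)))
  cases R with
  | nil =>
    have hlt : T x < T y := by
      rcases hlast with h | ⟨R', f₁, f₂, h⟩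
      · exact h
      · simp at h
    simp only [List.nil_append, step]
    have hsub : E ⊆ insert (x, y) E := Finset.subset_insert _ _
    refine ⟨?_, ?_, hdisp, hnodup, Or.inl ⟨es, hes, rfl, fun e he => ?_⟩⟩
    · intro a b hab
      rcases Finset.mem_insert.1 hab with h | h
      · obtain ⟨rfl, rfl⟩ := Prod.mk.inj h
        exact hlt
      · exact hT a b h
    · exact Finset.insert_subset hxy hEG
    · rcases hlog e he with h | ⟨-, h1, h2⟩
      · exact Edge.mono_trans hsub h
      · exact transGen_through (Finset.mem_insert_self _ _) (Edge.mono_refl hsub h1)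
          (Edge.mono_refl hsub h2)
  | cons r R =>
    have hr := hR r (by simp)
    have hR' : ∀ r ∈ R, ValidCall E T x y r := fun r' h => hR r' (by simp [h])
    rcases r with ⟨u, v⟩ | ⟨u, v⟩ | ⟨u, v, f₁, f₂⟩
    · exact hr.elim
    · exact hr.elim
    obtain ⟨hyu, hvx, hf₁, hf₂⟩ := hr
    have huv_path : TransGen (Edge G) v u :=
      transGen_through hxy (Edge.mono_refl hEG hvx) (Edge.mono_refl hEG hyu)
    have hne : u ≠ v := by rintro rfl; exact hG _ huv_path
    -- If the call being dropped is the final `Reorder(y,x)`, then $x<y$ already holds.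
    have hlast' : T v < T u → T x < T y ∨ ∃ R' f₁ f₂, R = R' ++ [Instr.reorder y x f₁ f₂] := by
      intro hlt
      rcases hlast with h | ⟨R', g₁, g₂, h⟩
      · exact Or.inl h
      · cases R' with
        | nil =>
          simp only [List.nil_append, List.cons.injEq, Instr.reorder.injEq] at h
          obtain ⟨⟨rfl, rfl, -, -⟩, -⟩ := h
          exact Or.inl hlt
        | cons a R' =>
          simp only [List.cons_append, List.cons.injEq] at h
          exact Or.inr ⟨R', g₁, g₂, h.2⟩
    simp only [List.cons_append, step]
    split_ifs with h1 h2
    · refine ⟨hT, hEG, hdisp, hnodup, Or.inr ⟨es, x, y, R, hes, hxy, rfl, hR', ?_, hlog⟩⟩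
      exact hlast' (lt_of_le_of_ne h1 fun h => hne (T.injective h).symm)
    · rw [not_le] at h1
      have hEuv : (u, v) ∉ E := fun h => hG v (huv_path.tail (hEG h))
      have hA : ∀ w, (u, w) ∈ E → T v ≤ T w := fun w hw => le_of_setA_eq_empty ht hT hf₁ h2.1 hw
      have hB : ∀ w, (w, v) ∈ E → T w ≤ T u := fun w hw => le_of_setB_eq_empty ht hT hf₂ h2.2 hw
      have hT' := isTopologicalOrder_swap hT h1 hEuv hA hB
      have hup : ∀ {a}, ReflTransGen (Edge E) y a → T a ≤ (Equiv.swap u v).trans T a := by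
        intro a ha
        rw [swap_trans_apply]
        split_ifs with h3 h4
        · rw [h3]; exact h1.le
        · exact (hcycle ha (h4 ▸ hvx)).elim
        · exact le_rfl
      have hdown : ∀ {a}, ReflTransGen (Edge E) a x → (Equiv.swap u v).trans T a ≤ T a := by
        intro a ha
        rw [swap_trans_apply]
        split_ifs with h3 h4
        · exact (hcycle hyu (h3 ▸ ha)).elim
        · rw [h4]; exact h1.le
        · exact le_rfl
      have hswapped : (Equiv.swap u v).trans T v < (Equiv.swap u v).trans T u := by
        simpa [swap_trans_apply, hne.symm] using h1
      refine ⟨hT', hEG, fun w => ?_, ?_, Or.inr ⟨es, x, y, R, hes, hxy, rfl, ?_, ?_, ?_⟩⟩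
      · rw [swap_displacement h1, hdisp w]
        simp [add_assoc]
      · simp only [EachPairSwappedAtMostOnce, List.map_append, List.map_cons, List.map_nil]
        refine List.nodup_append.2 ⟨hnodup, by simp, ?_⟩
        intro a ha b hb hab
        rw [List.mem_singleton] at hb
        obtain ⟨⟨⟨c, d⟩, m⟩, he, rfl⟩ := List.mem_map.1 ha
        subst hb
        have hlt : T d < T c := by
          rcases hlog _ he with h | h
          · exact hT.lt_of_transGen h
          · exact h.1
        have hpath : TransGen (Edge G) d c := by
          rcases hlog _ he with h | ⟨-, h3, h4⟩
          · exact Edge.mono_trans hEG h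
          · exact transGen_through hxy (Edge.mono_refl hEG h3) (Edge.mono_refl hEG h4)
        -- An earlier swap with the same orientation contradicts the current order; one with the
        -- opposite orientation gives paths both ways, hence a cycle.
        rcases Sym2.eq_iff.1 hab with ⟨h3, h4⟩ | ⟨h3, h4⟩
        · simp only at h3 h4
          subst h3; subst h4
          exact lt_asymm h1 hlt
        · simp only at h3 h4
          subst h3; subst h4
          exact hG _ (hpath.trans huv_path)
      · intro r hr
        have hv := hR' r hr
        rcases r with _ | _ | ⟨a, b, g₁, g₂⟩
        · exact hv
        · exact hv
        · obtain ⟨ha, hb, hg₁, hg₂⟩ := hv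
          exact ⟨ha, hb,
            fun hg w hw => (hdown hb).trans_lt ((hg₁ hg w hw).trans_le (hup (ha.tail hw))),
            fun hg w hw => (hdown (hb.head hw)).trans_lt ((hg₂ hg w hw).trans_le (hup ha))⟩
      · rcases hlast with h | ⟨R', g₁, g₂, h⟩
        · exact Or.inl ((hdown .refl).trans_lt (h.trans_le (hup .refl)))
        · cases R' with
          | nil =>
            simp only [List.nil_append, List.cons.injEq, Instr.reorder.injEq] at h
            obtain ⟨⟨rfl, rfl, -, -⟩, -⟩ := h
            exact Or.inl hswapped
          | cons a R' =>
            simp only [List.cons_append, List.cons.injEq] at h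
            exact Or.inr ⟨R', g₁, g₂, h.2⟩
      · intro e he
        rcases List.mem_append.1 he with he | he
        · rcases hlog e he with h | ⟨h3, h4, h5⟩
          · exact Or.inl h
          · exact Or.inr ⟨(hdown h4).trans_lt (h3.trans_le (hup h5)), h4, h5⟩
        · rw [List.mem_singleton] at he
          subst he
          exact Or.inr ⟨hswapped, hvx, hyu⟩
    · rw [not_le] at h1
      refine ⟨hT, hEG, hdisp, hnodup, Or.inr ⟨es, x, y,
        subcalls T u v (setA t E T u v f₁) (setB t E T u v f₂) ++ R, hes, hxy,
        (List.append_assoc _ _ _).symm, ?_, ?_, hlog⟩⟩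
      · intro r hr
        rcases List.mem_append.1 hr with hr | hr
        · obtain ⟨u', hu', v', hv', -, rfl⟩ := mem_subcalls.1 hr
          have hyu' : ReflTransGen (Edge E) y u' := by
            rcases Finset.mem_insert.1 hu' with rfl | h
            exacts [hyu, hyu.tail (edge_of_mem_setA h).1]
          have hvx' : ReflTransGen (Edge E) v' x := by
            rcases Finset.mem_insert.1 hv' with rfl | h
            exacts [hvx, hvx.head (edge_of_mem_setB h).1]
          have huu' : T u ≤ T u' := by
            rcases Finset.mem_insert.1 hu' with rfl | h
            exacts [le_rfl, (hT _ _ (edge_of_mem_setA h).1).le]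
          have hvv' : T v' ≤ T v := by
            rcases Finset.mem_insert.1 hv' with rfl | h
            exacts [le_rfl, (hT _ _ (edge_of_mem_setB h).1).le]
          refine ⟨hyu', hvx', fun hf w hw => ?_, fun hf w hw => ?_⟩
          -- The flag records that the parent call found $A=\emptyset$, so out-neighbours of $u$ lie
          -- at or beyond $v$, hence at or beyond $v'$. Equality with $v'$ would give a path from
          -- $y$ to $x$.
          · obtain ⟨rfl, hA⟩ := of_decide_eq_true hf
            refine lt_of_le_of_ne (hvv'.trans (le_of_setA_eq_empty ht hT hf₁ hA hw)) fun h => ?_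
            exact hcycle (hyu'.tail hw) (T.injective h ▸ hvx')
          · obtain ⟨rfl, hB⟩ := of_decide_eq_true hf
            refine lt_of_le_of_ne ((le_of_setB_eq_empty ht hT hf₂ hB hw).trans huu') fun h => ?_
            exact hcycle hyu' (T.injective h ▸ hvx'.head hw)
        · exact hR' r hr
      · obtain ⟨S, g₁, g₂, hS⟩ := subcalls_eq_append h1
          (fun w hw => hT _ _ (edge_of_mem_setA (t := t) (f := f₁) hw).1)
          (fun w hw => hT _ _ (edge_of_mem_setB (t := t) (f := f₂) hw).1)
        rcases hlast with h | ⟨R', k₁, k₂, h⟩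
        · exact Or.inl h
        · right
          cases R' with
          | nil =>
            simp only [List.nil_append, List.cons.injEq, Instr.reorder.injEq] at h
            obtain ⟨⟨rfl, rfl, -, -⟩, rfl⟩ := h
            exact ⟨S, g₁, g₂, by rw [hS, List.append_nil]⟩
          | cons a R' =>
            simp only [List.cons_append, List.cons.injEq] at h
            rw [h.2]
            exact ⟨_, k₁, k₂, (List.append_assoc _ _ _).symm⟩

theorem invariant_step {p : ℕ} {t : Fin (p + 2) → ℝ}
    (ht : t (Fin.last (p + 1)) = Fintype.card V) {G : Finset (V × V)} (hG : Acyclic G)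
    {T₀ : Order V} {s : State V} (hs : Invariant G T₀ s) : Invariant G T₀ (step t s) :=
  hs.phase.elim (invariant_step_idle hs) (invariant_step_busy ht hG hs)

/-! ### Termination -/

theorem Invariant.length_swaps_le {G : Finset (V × V)} {T₀ : Order V} {s : State V}
    (hs : Invariant G T₀ s) : s.swaps.length ≤ Fintype.card (Sym2 V) := by
  have := List.Nodup.length_le_card hs.swappedOnce
  simpa using this

/-- Some state reachable from `s` satisfies `P`. -/
def Eventually {p : ℕ} (t : Fin (p + 2) → ℝ) (P : State V → Prop) (s : State V) : Prop :=
  ∃ N : ℕ, P ((step t)^[N] s)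

theorem Eventually.of_step {p : ℕ} {t : Fin (p + 2) → ℝ} {P : State V → Prop} {s : State V}
    (h : Eventually t P (step t s)) : Eventually t P s := by
  obtain ⟨N, hN⟩ := h
  exact ⟨N + 1, hN⟩

/-- An active call of `Reorder` leads to a swap. -/
theorem eventually_swap {p : ℕ} {t : Fin (p + 2) → ℝ}
    (ht : t (Fin.last (p + 1)) = Fintype.card V) {G : Finset (V × V)} (hG : Acyclic G)
    {T₀ : Order V} (d : ℕ) : ∀ (s : State V) (u v : V) (f₁ f₂ : Bool) (rest : List (Instr V)),
    Invariant G T₀ s → s.todo = Instr.reorder u v f₁ f₂ :: rest → s.T u < s.T v →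
    (s.T v : ℕ) - s.T u = d →
    Eventually t (fun s' => Invariant G T₀ s' ∧ s'.swaps.length = s.swaps.length + 1) s := by
  induction d using Nat.strong_induction_on with
  | _ d ih =>
    intro s u v f₁ f₂ rest hs htodo huv hd
    apply Eventually.of_step
    have hs' := invariant_step ht hG hs (t := t)
    obtain ⟨E, T, todo, swaps⟩ := s
    simp only at htodo huv hd
    subst htodo
    simp only [step, if_neg (not_le.2 huv)] at hs' ⊢
    split_ifs at hs' ⊢ with h
    · exact ⟨0, hs', by simp⟩
    · have hT := hs.topological
      obtain ⟨u', v', g₁, g₂, R, hR, hlt, hlt'⟩ := subcalls_eq_cons huv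
        (fun w hw => ⟨hT _ _ (edge_of_mem_setA hw).1, (edge_of_mem_setA hw).2⟩)
        (fun w hw => ⟨(edge_of_mem_setB hw).2, hT _ _ (edge_of_mem_setB hw).1⟩) h
      exact ih _ (hd ▸ hlt') _ u' v' g₁ g₂ (R ++ rest) hs' (by rw [hR]; rfl) hlt rfl

/-- A bound on the number of steps needed to clear a stack of instructions none of which is an
active call of `Reorder`. -/
def weight : List (Instr V) → ℕ
  | [] => 0
  | Instr.insertEdge _ _ :: l => weight l + 3
  | _ :: l => weight l + 1

/-- Every step other than an active `Reorder` lowers `weight`: an insertion counts 3 because it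
leaves at most two instructions of weight 1. An active `Reorder` leads to a swap by
`eventually_swap`. -/
theorem halts_or_swap {p : ℕ} {t : Fin (p + 2) → ℝ}
    (ht : t (Fin.last (p + 1)) = Fintype.card V) {G : Finset (V × V)} (hG : Acyclic G)
    {T₀ : Order V} (m : ℕ) : ∀ s : State V, Invariant G T₀ s → weight s.todo = m →
    Eventually t (fun s' => Invariant G T₀ s' ∧
      (s'.todo = [] ∨ s'.swaps.length = s.swaps.length + 1)) s := by
  induction m using Nat.strong_induction_on with
  | _ m ih =>
    intro s hs hm
    have hs' := invariant_step ht hG hs (t := t)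
    obtain ⟨E, T, todo, swaps⟩ := s
    cases todo with
    | nil => exact ⟨0, hs, Or.inl rfl⟩
    | cons r rest =>
      rcases r with ⟨u, v⟩ | ⟨u, v⟩ | ⟨u, v, f₁, f₂⟩
      · apply Eventually.of_step
        simp only [weight] at hm
        simp only [step] at hs' ⊢
        split_ifs at hs' ⊢ with h
        · exact ih (weight rest + 2) (by omega) _ hs' rfl
        · exact ih (weight rest + 1) (by omega) _ hs' rfl
      · apply Eventually.of_step
        simp only [weight] at hm
        simp only [step] at hs' ⊢
        exact ih (weight rest) (by omega) _ hs' rfl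
      · by_cases h : T v ≤ T u
        · apply Eventually.of_step
          simp only [weight] at hm
          simp only [step, if_pos h] at hs' ⊢
          exact ih (weight rest) (by omega) _ hs' rfl
        · obtain ⟨N, h1, h2⟩ := eventually_swap ht hG _ _ u v f₁ f₂ rest hs rfl (not_le.1 h) rfl
          exact ⟨N, h1, Or.inr h2⟩

/-- Each swap uses up a fresh unordered pair, so the number of unused pairs decreases. -/
theorem eventually_halts {p : ℕ} {t : Fin (p + 2) → ℝ}
    (ht : t (Fin.last (p + 1)) = Fintype.card V) {G : Finset (V × V)} (hG : Acyclic G)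
    {T₀ : Order V} (m : ℕ) : ∀ s : State V, Invariant G T₀ s →
    Fintype.card (Sym2 V) - s.swaps.length = m →
    Eventually t (fun s' => Invariant G T₀ s' ∧ s'.todo = []) s := by
  induction m using Nat.strong_induction_on with
  | _ m ih =>
    intro s hs hm
    obtain ⟨N, h1, h2⟩ := halts_or_swap ht hG _ s hs rfl
    rcases h2 with h2 | h2
    · exact ⟨N, h1, h2⟩
    · have hle := h1.length_swaps_le
      obtain ⟨M, hM⟩ := ih _ (by omega) _ h1 rfl
      exact ⟨M + N, by rwa [Function.iterate_add_apply]⟩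

/-! ### The bound on the sum of the truncated distances -/

/-- Swapped pairs remain reversed, which makes all terms of the potential nonnegative. -/
theorem Invariant.lt_of_mem_swaps {G : Finset (V × V)} {T₀ : Order V} {s : State V}
    (hs : Invariant G T₀ s) {e : (V × V) × ℕ} (he : e ∈ s.swaps) : s.T e.1.2 < s.T e.1.1 := by
  rcases hs.phase with ⟨_, _, _, h⟩ | ⟨_, _, _, _, _, _, _, _, _, h⟩
  · exact hs.topological.lt_of_transGen (h e he)
  · rcases h e he with h | h
    exacts [hs.topological.lt_of_transGen h, h.1]

/-- The lookup sees one matching entry and all entries are nonnegative, so no uniqueness is needed.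
-/
theorem D_le_sum (L : List ((V × V) × ℕ)) (u v : V) :
    D L u v ≤ (L.map fun e => if e.1 = (u, v) then e.2 else 0).sum := by
  induction L with
  | nil => simp [D]
  | cons e L ih =>
    obtain ⟨q, m⟩ := e
    unfold D at ih ⊢
    by_cases h : q = (u, v)
    · subst h
      simp
    · have : ((u, v) == q) = false := by simpa using Ne.symm h
      simpa [List.lookup_cons, this, h] using ih

theorem exists_mem_of_D_ne_zero {L : List ((V × V) × ℕ)} {u v : V} (h : D L u v ≠ 0) :
    ∃ e ∈ L, e.1 = (u, v) := by
  by_contra! hne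
  apply h
  have := D_le_sum L u v
  rw [List.map_congr_left (g := fun _ => 0) fun e he => if_neg (hne e he)] at this
  simpa using this

theorem sum_D_mul_le_list (L : List ((V × V) × ℕ)) (g : V → V → ℕ) :
    ∑ u, ∑ v, D L u v * g u v ≤ (L.map fun e => e.2 * g e.1.1 e.1.2).sum := by
  have key : ∑ u, ∑ v, (L.map fun e => if e.1 = (u, v) then e.2 else 0).sum * g u v =
      (L.map fun e => e.2 * g e.1.1 e.1.2).sum := by
    induction L with
    | nil => simp
    | cons e L ih =>
      obtain ⟨⟨a, b⟩, m⟩ := e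
      simp only [List.map_cons, List.sum_cons, add_mul, Finset.sum_add_distrib, ih,
        Prod.mk.injEq]
      congr 1
      rw [Finset.sum_eq_single a, Finset.sum_eq_single b]
      · simp
      · intro c _ hc; simp [hc.symm]
      · simp
      · intro c _ hc; simp [hc.symm]
      · simp
  rw [← key]
  exact Finset.sum_le_sum fun u _ => Finset.sum_le_sum fun v _ =>
    Nat.mul_le_mul_right _ (D_le_sum L u v)

/-- Summation by vertices is exchanged for summation by swaps: each swap contributes at its two
ends, with opposite signs. -/
theorem sum_mul_displacement (L : List ((V × V) × ℕ)) (g : V → ℤ) :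
    ∑ w, g w * (L.map (displacement w)).sum =
      (L.map fun e => (e.2 : ℤ) * (g e.1.1 - g e.1.2)).sum := by
  induction L with
  | nil => simp
  | cons e L ih =>
    simp only [List.map_cons, List.sum_cons, mul_add, Finset.sum_add_distrib, ih]
    simp only [displacement, mul_sub, Finset.sum_sub_distrib, mul_ite, mul_zero,
      Finset.sum_ite_eq, Finset.mem_univ, if_true]
    ring

/-- The distances of the swaps, weighted by the distance in the current order, sum to at most
`n ^ 3`. -/
theorem Invariant.sum_D_mul_le {G : Finset (V × V)} {T₀ : Order V} {s : State V}
    (hs : Invariant G T₀ s) :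
    ∑ u, ∑ v, D s.swaps u v * ((s.T u : ℕ) - (s.T v : ℕ)) ≤ Fintype.card V ^ 3 := by
  refine (sum_D_mul_le_list s.swaps fun u v => (s.T u : ℕ) - (s.T v : ℕ)).trans ?_
  -- The truncated subtraction is exact here because each logged pair is reversed in the current
  -- order.
  have h1 : (((s.swaps.map fun e => e.2 * ((s.T e.1.1 : ℕ) - (s.T e.1.2 : ℕ))).sum : ℕ) : ℤ) =
      ∑ w, ((s.T w : ℕ) : ℤ) * (s.swaps.map (displacement w)).sum := by
    rw [sum_mul_displacement, Nat.cast_list_sum, List.map_map]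
    congr 1
    apply List.map_congr_left
    intro e he
    have := hs.lt_of_mem_swaps he
    simp only [Function.comp_apply]
    rw [Nat.cast_mul, Nat.cast_sub (le_of_lt this)]
  have h2 : ∑ w, ((s.T w : ℕ) : ℤ) * (s.swaps.map (displacement w)).sum ≤
      ∑ _w : V, (Fintype.card V : ℤ) * Fintype.card V := by
    refine Finset.sum_le_sum fun w _ => ?_
    -- The displacements of a vertex telescope to its current position minus its initial one.
    have hd : (s.swaps.map (displacement w)).sum ≤ (Fintype.card V : ℤ) := by
      have := hs.displaced w
      have := (s.T w).isLt
      omega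
    have h3 : ((s.T w : ℕ) : ℤ) ≤ Fintype.card V := by exact_mod_cast (s.T w).isLt.le
    calc _ ≤ ((s.T w : ℕ) : ℤ) * (Fintype.card V : ℤ) :=
          mul_le_mul_of_nonneg_left hd (by positivity)
      _ ≤ _ := mul_le_mul_of_nonneg_right h3 (by positivity)
  rw [← h1, Finset.sum_const, Finset.card_univ, nsmul_eq_mul] at h2
  have h3 : (Fintype.card V : ℤ) * (Fintype.card V * Fintype.card V) =
    ((Fintype.card V ^ 3 : ℕ) : ℤ) := by push_cast; ring
  rw [h3] at h2
  exact_mod_cast h2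

theorem Dk_le_D (L : List ((V × V) × ℕ)) (k : ℝ) (u v : V) : Dk L k u v ≤ D L u v := by
  unfold Dk
  split_ifs with h
  exacts [le_rfl, (not_le.1 h).le]

theorem Dk_le (L : List ((V × V) × ℕ)) (k : ℝ) (u v : V) : Dk L k u v ≤ k := by
  unfold Dk
  split_ifs with h
  exacts [h, le_rfl]

open Classical in
/-- At most `l` vertices lie before `u` at distance at most `l`. -/
theorem card_near_le (T : Order V) (u : V) {l : ℝ} (hl : 0 ≤ l) :
    ((Finset.univ.filter fun v => T v < T u ∧ (((T u : ℕ) - (T v : ℕ) : ℕ) : ℝ) ≤ l).card : ℝ)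
      ≤ l := by
  refine le_trans ?_ (Nat.floor_le hl)
  norm_cast
  rw [← Nat.add_sub_cancel (n := ⌊l⌋₊) (m := 1), ← Nat.card_Icc 1 ⌊l⌋₊]
  refine Finset.card_le_card_of_injOn (fun v => (T u : ℕ) - (T v : ℕ)) ?_ ?_
  · intro v hv
    simp only [Finset.coe_filter, Finset.mem_univ, true_and, Set.mem_ofPred_eq, Fin.lt_def] at hv
    simp only [Finset.coe_Icc, Set.mem_Icc]
    exact ⟨by omega, Nat.le_floor hv.2⟩
  · intro v hv w hw h
    simp only [Finset.coe_filter, Finset.mem_univ, true_and, Set.mem_ofPred_eq, Fin.lt_def] at hv hw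
    simp only at h
    exact T.injective (Fin.ext (by omega))

theorem Invariant.sum_Dk_le {G : Finset (V × V)} {T₀ : Order V} {s : State V}
    (hs : Invariant G T₀ s) {k : ℝ} (hk : 0 < k) :
    ∑ u : V, ∑ v : V, Dk s.swaps k u v ≤ 2 * (Fintype.card V : ℝ) ^ 2 * √k := by
  classical
  rcases isEmpty_or_nonempty V with hV | hV
  · simp
  set n : ℝ := (Fintype.card V : ℝ) with hn
  have hn0 : 0 < n := by rw [hn]; exact_mod_cast Fintype.card_pos
  have hsk : 0 < √k := Real.sqrt_pos.2 hk
  have hkk : √k * √k = k := Real.mul_self_sqrt hk.le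
  -- This cutoff balances the near cost $nlk$ against the far cost $n^3/l$.
  set l : ℝ := n / √k with hl
  have hl0 : 0 < l := by positivity
  -- Near pairs are charged $k$. A far swapped pair has gap greater than $l$, so $D\le
  -- D\cdot\mathrm{gap}/l$.
  have hpt : ∀ u v, Dk s.swaps k u v ≤
      (if s.T v < s.T u ∧ (((s.T u : ℕ) - (s.T v : ℕ) : ℕ) : ℝ) ≤ l then k else 0) +
        ((D s.swaps u v * ((s.T u : ℕ) - (s.T v : ℕ)) : ℕ) : ℝ) / l := by
    intro u v
    have hq : (0 : ℝ) ≤ ((D s.swaps u v * ((s.T u : ℕ) - (s.T v : ℕ)) : ℕ) : ℝ) / l := by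
      positivity
    have hDk := Dk_le_D s.swaps k u v
    split_ifs with h
    · linarith [Dk_le s.swaps k u v]
    · rw [zero_add]
      by_cases hD : D s.swaps u v = 0
      · rw [hD, Nat.cast_zero] at hDk
        exact hDk.trans hq
      · obtain ⟨e, he, heq⟩ := exists_mem_of_D_ne_zero hD
        have hlt := hs.lt_of_mem_swaps he
        rw [heq] at hlt
        have hgt : l < (((s.T u : ℕ) - (s.T v : ℕ) : ℕ) : ℝ) := by
          by_contra! hle
          exact h ⟨hlt, hle⟩
        refine hDk.trans ?_
        rw [le_div_iff₀ hl0, Nat.cast_mul]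
        exact mul_le_mul_of_nonneg_left hgt.le (by positivity)
  have hnear : ∑ u : V, ∑ v : V,
      (if s.T v < s.T u ∧ (((s.T u : ℕ) - (s.T v : ℕ) : ℕ) : ℝ) ≤ l then k else 0) ≤
        n * (l * k) := by
    have hconst : n * (l * k) = ∑ _u : V, l * k := by
      rw [Finset.sum_const, Finset.card_univ, nsmul_eq_mul]
    rw [hconst]
    refine Finset.sum_le_sum fun u _ => ?_
    rw [← Finset.sum_filter, Finset.sum_const, nsmul_eq_mul]
    exact mul_le_mul_of_nonneg_right (card_near_le s.T u hl0.le) hk.le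
  have hfar : ∑ u : V, ∑ v : V,
      ((D s.swaps u v * ((s.T u : ℕ) - (s.T v : ℕ)) : ℕ) : ℝ) / l ≤ n ^ 3 / l := by
    simp only [← Finset.sum_div]
    refine div_le_div_of_nonneg_right ?_ hl0.le
    rw [hn]
    exact_mod_cast hs.sum_D_mul_le
  calc _ ≤ ∑ u : V, ∑ v : V, _ :=
        Finset.sum_le_sum fun u _ => Finset.sum_le_sum fun v _ => hpt u v
    _ ≤ n * (l * k) + n ^ 3 / l := by
        simp only [Finset.sum_add_distrib]
        exact add_le_add hnear hfar
    _ = 2 * n ^ 2 * √k := by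
        have h1 : l * k = n * √k := by
          rw [hl, div_mul_eq_mul_div, div_eq_iff hsk.ne', mul_assoc, hkk]
        have h2 : n ^ 3 / l = n ^ 2 * √k := by
          rw [hl]
          field_simp
        rw [h1, h2]
        ring

end OnlineTopo

theorem mainTheorem4 :
    ∃ C : ℝ, 0 < C ∧
      ∀ (V : Type*) [Fintype V] [DecidableEq V]
        (p : ℕ) (t : Fin (p + 2) → ℝ),
        √(Fintype.card V : ℝ) < t 0 → StrictMono t → t (Fin.last (p + 1)) = Fintype.card V →
      ∀ (E₀ : Finset (V × V)) (T₀ : OnlineTopo.Order V) (es : List (V × V)),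
        OnlineTopo.IsTopologicalOrder E₀ T₀ →
        OnlineTopo.Acyclic (E₀ ∪ es.toFinset) →
        ∃ s : OnlineTopo.State V,
          OnlineTopo.HaltsIn t (OnlineTopo.start E₀ T₀ es) s ∧
          OnlineTopo.EachPairSwappedAtMostOnce s.swaps ∧
          ∀ k : ℝ, √(Fintype.card V : ℝ) ≤ k → k ≤ Fintype.card V →
            ∑ u : V, ∑ v : V, OnlineTopo.Dk s.swaps k u v
              ≤ C * (Fintype.card V : ℝ) ^ 2 * √k := by
  refine ⟨2, two_pos, fun V _ _ p t _ _ ht E₀ T₀ es hT hG => ?_⟩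
  obtain ⟨N, hs, hN⟩ := OnlineTopo.eventually_halts ht hG _ _ (OnlineTopo.invariant_start hT) rfl
  refine ⟨_, ⟨N, rfl, hN⟩, hs.swappedOnce, fun k hk _ => ?_⟩
  -- For $n=0$ the range of $k$ is just $k=0$ and both sides vanish; otherwise $k\ge\sqrt n>0$.
  rcases isEmpty_or_nonempty V with hV | hV
  · simp
  · exact hs.sum_Dk_le
      ((Real.sqrt_pos.2 (Nat.cast_pos.2 Fintype.card_pos)).trans_le hk)
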